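/- Let $\mathbb K$ be a field and let $\mathbb K[x]\langle\partial\rangle\subset\mathbb K(x)\langle\partial\rangle$ be the rings of linear differential operators in $\partial=\frac{d}{dx}$ with coefficients in $\mathbb K[x]$ and in $\mathbb K(x)$. An operator $L\in\mathbb K[x]\langle\partial\rangle$ has bidegree at most $(d,r)$ if its order is at most $r$ and its coefficients have degree at most $d$ in $x$. For nonzero $L_1,\dots,L_k\in\mathbb K[x]\langle\partial\rangle$, $\mathrm{lclm}(L_1,\dots,L_k)$ denotes their primitive least common left multiple, that is, a nonzero common left multiple of least order in $\mathbb K(x)\langle\partial\rangle$, normalised so as to lie in $\mathbb K[x]\langle\partial\rangle$ with trivial content; it is unique up to a nonzero factor in $\mathbb K$. The cost of an algorithm is the number of operations in $\mathbb K$ (arithmetic operations and tests for zero) that it performs, and $f=\widetilde O(g)$ means that there are constants $C,c$ with $f\le C\,g\,\log(3+g)^c$ for all values $\ge 1$ of the integer parameters. Let $\alpha\ge 2$ and $\beta\ge 1$ be real constants. Suppose that we are given an algorithm which, on input any two nonzero operators $L_1,L_2\in\mathbb K[x]\langle\partial\rangle$ of bidegree at most $(D,R)$, computes $\mathrm{lclm}(L_1,L_2)$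 in $\widetilde O(R^\alpha D^\beta)$ operations in $\mathbb K$. Then there exists an algorithm which, for all $k\ge 1$ and on input any nonzero operators $L_1,\dots,L_k\in\mathbb K[x]\langle\partial\rangle$ of bidegree at most $(d,r)$, computes $\mathrm{lclm}(L_1,\dots,L_k)$ using $\widetilde O(k^{\alpha+2\beta}\,r^{\alpha+\beta}\,d^\beta)$ operations in $\mathbb K$. -/

import Mathlib

open Polynomial

noncomputable section

namespace DiffOps

/-! ### Linear differential operators

A linear differential operator `∑ aᵢ ∂ⁱ` over a commutative ring `F` is stored as the polynomial
`∑ aᵢ Xⁱ : F[X]`, the variable `X` standing for `∂` and the coefficients being written on the left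
of `∂`.  The product of operators is `opMul` below, not the product of polynomials. -/

/-- The operator `∂ Q`, computed with the commutation rule `∂ b = b ∂ + b′`. -/
def dMul {F : Type*} [CommRing F] [Differential F] (Q : F[X]) : F[X] :=
  Q * X + Differential.mapCoeffs Q

/-- The product `P Q = ∑ aᵢ (∂ⁱ Q)` of the differential operators `P = ∑ aᵢ ∂ⁱ` and `Q`. -/
def opMul {F : Type*} [CommRing F] [Differential F] (P Q : F[X]) : F[X] :=
  P.sum fun i a => C a * dMul^[i] Q

/-- An additive map satisfying the Leibniz rule makes a ring a differential ring. -/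
@[reducible]
def differentialOfLeibniz {F : Type*} [CommRing F] (δ : F → F)
    (hadd : ∀ f g, δ (f + g) = δ f + δ g) (hmul : ∀ f g, δ (f * g) = f * δ g + g * δ f) :
    Differential F where
  deriv := Derivation.mk' (AddMonoidHom.mk' δ hadd).toIntLinearMap hmul

section RationalFunctions

variable {K : Type*} [Field K]

/-- The usual derivative of a rational function, by the quotient rule. -/
def ratDeriv (f : RatFunc K) : RatFunc K :=
  algebraMap K[X] (RatFunc K)
      (derivative f.num * f.denom - f.num * derivative f.denom) /
    algebraMap K[X] (RatFunc K) f.denom ^ 2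

/-- The quotient rule holds for every representation of a rational function as a fraction. -/
theorem ratDeriv_div (p q : K[X]) (hq : q ≠ 0) :
    ratDeriv (algebraMap K[X] (RatFunc K) p / algebraMap K[X] (RatFunc K) q) =
      algebraMap K[X] (RatFunc K) (derivative p * q - p * derivative q) /
        algebraMap K[X] (RatFunc K) q ^ 2 := by
  set f : RatFunc K := algebraMap K[X] (RatFunc K) p / algebraMap K[X] (RatFunc K) q with hf
  have hd : f.denom ≠ 0 := f.denom_ne_zero
  have hq' : algebraMap K[X] (RatFunc K) q ≠ 0 := RatFunc.algebraMap_ne_zero hq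
  have hd' : algebraMap K[X] (RatFunc K) f.denom ≠ 0 := RatFunc.algebraMap_ne_zero hd
  have h1 : f.num * q = p * f.denom := by
    apply RatFunc.algebraMap_injective K
    have h2 : algebraMap K[X] (RatFunc K) f.num / algebraMap K[X] (RatFunc K) f.denom =
        algebraMap K[X] (RatFunc K) p / algebraMap K[X] (RatFunc K) q := by
      rw [RatFunc.num_div_denom]
    rw [div_eq_div_iff hd' hq'] at h2
    simpa [map_mul] using h2
  have h3 := congrArg derivative h1
  simp only [derivative_mul] at h3
  unfold ratDeriv
  rw [div_eq_div_iff (pow_ne_zero 2 hd') (pow_ne_zero 2 hq'), ← map_pow, ← map_pow, ← map_mul,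
    ← map_mul]
  congr 1
  linear_combination (q * f.denom) * h3 -
    (q * derivative f.denom + f.denom * derivative q) * h1

/-- The derivative of rational functions is additive. -/
theorem ratDeriv_add (f g : RatFunc K) : ratDeriv (f + g) = ratDeriv f + ratDeriv g := by
  induction f using RatFunc.induction_on with
  | f p q hq =>
  induction g using RatFunc.induction_on with
  | f p' q' hq' =>
  have h := RatFunc.algebraMap_ne_zero hq
  have h' := RatFunc.algebraMap_ne_zero hq'
  rw [div_add_div _ _ h h', ← map_mul, ← map_mul, ← map_mul, ← map_add,
    ratDeriv_div _ _ (mul_ne_zero hq hq'), ratDeriv_div _ _ hq, ratDeriv_div _ _ hq']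
  simp only [map_mul, map_add, map_sub, derivative_mul]
  field_simp
  ring

/-- The derivative of rational functions satisfies the Leibniz rule. -/
theorem ratDeriv_mul (f g : RatFunc K) :
    ratDeriv (f * g) = f * ratDeriv g + g * ratDeriv f := by
  induction f using RatFunc.induction_on with
  | f p q hq =>
  induction g using RatFunc.induction_on with
  | f p' q' hq' =>
  have h := RatFunc.algebraMap_ne_zero hq
  have h' := RatFunc.algebraMap_ne_zero hq'
  rw [div_mul_div_comm, ← map_mul, ← map_mul,
    ratDeriv_div _ _ (mul_ne_zero hq hq'), ratDeriv_div _ _ hq, ratDeriv_div _ _ hq']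
  simp only [map_mul, map_add, map_sub, derivative_mul]
  field_simp
  ring

/-- `K(x)` as a differential field, with the derivation `d/dx`. -/
instance instDifferentialRatFunc : Differential (RatFunc K) :=
  differentialOfLeibniz ratDeriv ratDeriv_add ratDeriv_mul

/-- An operator with polynomial coefficients, an element of `K[x]⟨∂⟩`, regarded as an element of
`K(x)⟨∂⟩`. -/
def toRat (L : K[X][X]) : (RatFunc K)[X] :=
  L.map (algebraMap K[X] (RatFunc K))

/-- `M` is a common left multiple of `L₁, …, L_k` in `K(x)⟨∂⟩`. -/
def IsCLM {k : ℕ} (L : Fin k → (RatFunc K)[X]) (M : (RatFunc K)[X]) : Prop :=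
  M ≠ 0 ∧ ∀ i, ∃ Q : (RatFunc K)[X], M = opMul Q (L i)

/-- `M` is a primitive least common left multiple of `L₁, …, L_k`: a common left multiple of least
order in `K(x)⟨∂⟩` which has polynomial coefficients without a nonconstant common factor.  It is
unique up to multiplication by a nonzero constant of `K`. -/
def IsPrimitiveLCLM {k : ℕ} (L : Fin k → K[X][X]) (M : K[X][X]) : Prop :=
  IsCLM (fun i => toRat (L i)) (toRat M) ∧
  (∀ M' : (RatFunc K)[X], IsCLM (fun i => toRat (L i)) M' → M.natDegree ≤ M'.natDegree) ∧
  M.IsPrimitive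

/-- `L` has bidegree at most `(d, r)` in `(x, ∂)`: its order is at most `r` and its coefficients
have degree at most `d`. -/
def BidegreeLE (d r : ℕ) (L : K[X][X]) : Prop :=
  L.natDegree ≤ r ∧ ∀ i, (L.coeff i).natDegree ≤ d

end RationalFunctions

/-! ### Algorithms over a field, with a count of the operations in the field

Data are trees whose leaves are field elements or the empty tree `nil`; lists are coded as usual by
`nil` and pairs, and natural numbers as lists of `nil`'s.  An algorithm is one fixed finite program
for inputs of all sizes.  It may handle trees freely, but field elements can only be moved
around, combined by the four arithmetic operations, and tested for being zero. -/

/-- The data on which programs operate. -/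
inductive Data (K : Type*) where
  | nil : Data K
  | scal (a : K) : Data K
  | pair (u v : Data K) : Data K

/-- The arithmetic operations in the field. -/
inductive ArithOp where
  | add | sub | mul | div

/-- The value of an arithmetic operation. -/
def ArithOp.eval {K : Type*} [Field K] : ArithOp → K → K → K
  | .add, a, b => a + b
  | .sub, a, b => a - b
  | .mul, a, b => a * b
  | .div, a, b => a / b

/-- Programs.  Each of them transforms one datum into another. -/
inductive Prog (K : Type*) where
  | id : Prog K
  | const (c : Data K) : Prog K
  | fst : Prog K
  | snd : Prog K
  | pair (p q : Prog K) : Prog K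
  | comp (q p : Prog K) : Prog K
  | arith (o : ArithOp) : Prog K
  | ifNil (c p q : Prog K) : Prog K
  | ifZero (c p q : Prog K) : Prog K
  | loop (c p : Prog K) : Prog K

/-- `Eval P v w t`: on input `v` the program `P` halts with output `w`, having performed exactly `t`
operations in `K` (arithmetic operations and tests for zero).  A division by zero, like any other
instruction applied to data of the wrong form, leaves the program without a result.

* `pair p q` returns the pair of the results of `p` and `q`;
* `comp q p` runs `p` and then `q` on the result of `p`;
* `ifNil c p q` runs `p` or `q` on its input, according to whether `c` returns `nil` on it;
* `ifZero c p q` runs `p` or `q` on its input, according to whether `c` returns the scalar zero;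
* `loop c p` runs `p` again and again, until `c` returns `nil`. -/
inductive Eval {K : Type*} [Field K] : Prog K → Data K → Data K → ℕ → Prop
  | id (v) : Eval .id v v 0
  | const (c v) : Eval (.const c) v c 0
  | fst (u v) : Eval .fst (.pair u v) u 0
  | snd (u v) : Eval .snd (.pair u v) v 0
  | pair {p q v w₁ w₂ t₁ t₂} : Eval p v w₁ t₁ → Eval q v w₂ t₂ →
      Eval (.pair p q) v (.pair w₁ w₂) (t₁ + t₂)
  | comp {q p v w z t₁ t₂} : Eval p v w t₁ → Eval q w z t₂ → Eval (.comp q p) v z (t₁ + t₂)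
  | arith (o : ArithOp) (a b : K) : (o = .div → b ≠ 0) →
      Eval (.arith o) (.pair (.scal a) (.scal b)) (.scal (o.eval a b)) 1
  | ifNil_true {c p q v w t₁ t₂} : Eval c v .nil t₁ → Eval p v w t₂ →
      Eval (.ifNil c p q) v w (t₁ + t₂)
  | ifNil_false {c p q v u w t₁ t₂} : Eval c v u t₁ → u ≠ .nil → Eval q v w t₂ →
      Eval (.ifNil c p q) v w (t₁ + t₂)
  | ifZero_true {c p q v w t₁ t₂} : Eval c v (.scal 0) t₁ → Eval p v w t₂ →
      Eval (.ifZero c p q) v w (t₁ + 1 + t₂)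
  | ifZero_false {c p q v w t₁ t₂} {a : K} : Eval c v (.scal a) t₁ → a ≠ 0 → Eval q v w t₂ →
      Eval (.ifZero c p q) v w (t₁ + 1 + t₂)
  | loop_stop {c p v t} : Eval c v .nil t → Eval (.loop c p) v v t
  | loop_step {c p v u w z t₁ t₂ t₃} : Eval c v u t₁ → u ≠ .nil → Eval p v w t₂ →
      Eval (.loop c p) w z t₃ → Eval (.loop c p) v z (t₁ + t₂ + t₃)

/-- Programs are deterministic: the output and the number of operations depend only on the
input. -/
theorem Eval.deterministic {K : Type*} [Field K] {P : Prog K} {v w w' : Data K} {t t' : ℕ}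
    (h : Eval P v w t) (h' : Eval P v w' t') : w = w' ∧ t = t' := by
  induction h generalizing w' t' with
  | id | const | fst | snd | arith => cases h'; exact ⟨rfl, rfl⟩
  | pair _ _ i₁ i₂ =>
    cases h' with
    | pair a b =>
      obtain ⟨rfl, rfl⟩ := i₁ a
      obtain ⟨rfl, rfl⟩ := i₂ b
      exact ⟨rfl, rfl⟩
  | comp _ _ i₁ i₂ =>
    cases h' with
    | comp a b =>
      obtain ⟨rfl, rfl⟩ := i₁ a
      obtain ⟨rfl, rfl⟩ := i₂ b
      exact ⟨rfl, rfl⟩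
  | ifNil_true _ _ i₁ i₂ =>
    cases h' with
    | ifNil_true a b =>
      obtain ⟨_, rfl⟩ := i₁ a
      obtain ⟨rfl, rfl⟩ := i₂ b
      exact ⟨rfl, rfl⟩
    | ifNil_false a n b => exact absurd (i₁ a).1.symm n
  | ifNil_false _ n _ i₁ i₂ =>
    cases h' with
    | ifNil_true a b => exact absurd (i₁ a).1 n
    | ifNil_false a _ b =>
      obtain ⟨_, rfl⟩ := i₁ a
      obtain ⟨rfl, rfl⟩ := i₂ b
      exact ⟨rfl, rfl⟩
  | ifZero_true _ _ i₁ i₂ =>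
    cases h' with
    | ifZero_true a b =>
      obtain ⟨_, rfl⟩ := i₁ a
      obtain ⟨rfl, rfl⟩ := i₂ b
      exact ⟨rfl, rfl⟩
    | ifZero_false a n b => exact absurd (Data.scal.inj (i₁ a).1).symm n
  | ifZero_false _ n _ i₁ i₂ =>
    cases h' with
    | ifZero_true a b => exact absurd (Data.scal.inj (i₁ a).1) n
    | ifZero_false a _ b =>
      obtain ⟨_, rfl⟩ := i₁ a
      obtain ⟨rfl, rfl⟩ := i₂ b
      exact ⟨rfl, rfl⟩
  | loop_stop _ i₁ =>
    cases h' with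
    | loop_stop a => exact ⟨rfl, (i₁ a).2⟩
    | loop_step a n b => exact absurd (i₁ a).1.symm n
  | loop_step _ n _ _ i₁ i₂ i₃ =>
    cases h' with
    | loop_stop a => exact absurd (i₁ a).1 n
    | loop_step a _ b c =>
      obtain ⟨_, rfl⟩ := i₁ a
      obtain ⟨rfl, rfl⟩ := i₂ b
      obtain ⟨rfl, rfl⟩ := i₃ c
      exact ⟨rfl, rfl⟩

/-- A list of data as one datum. -/
def Data.ofList {K : Type*} : List (Data K) → Data K
  | [] => .nil
  | v :: l => .pair v (ofList l)

section Encoding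

variable {K : Type*} [Field K]

/-- A polynomial is represented by the list of its coefficients, leading coefficient first. -/
def encodePoly (p : K[X]) : Data K :=
  Data.ofList (p.coeffList.map Data.scal)

/-- An operator is represented by the list of its coefficients, leading coefficient first. -/
def encodeOp (L : K[X][X]) : Data K :=
  Data.ofList (L.coeffList.map encodePoly)

/-- A family of operators is represented by the list of its members. -/
def encodeOps {k : ℕ} (L : Fin k → K[X][X]) : Data K :=
  Data.ofList (List.ofFn fun i => encodeOp (L i))

/-- The program `P` computes the primitive LCLM of any `k` nonzero operators `L₁, …, L_k` in
`K[x]⟨∂⟩`, and it uses at most `T d r` operations in `K` when they have bidegree at most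
`(d, r)`. -/
def ComputesLCLM (P : Prog K) (k : ℕ) (T : ℕ → ℕ → ℕ) : Prop :=
  ∀ (d r : ℕ) (L : Fin k → K[X][X]), (∀ i, L i ≠ 0) → (∀ i, BidegreeLE d r (L i)) →
    ∃ (M : K[X][X]) (t : ℕ), IsPrimitiveLCLM L M ∧ Eval P (encodeOps L) (encodeOp M) t ∧ t ≤ T d r

end Encoding

/-- `f = Õ(g)` on the set `S` of parameters: `f ≤ C g log(3 + g)ᶜ` for some constants `C` and
`c`. -/
def IsSoftO {ι : Type*} (S : Set ι) (f g : ι → ℝ) : Prop :=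
  ∃ (C : ℝ) (c : ℕ), ∀ n ∈ S, f n ≤ C * g n * Real.log (3 + g n) ^ c

end DiffOps

end

noncomputable section

namespace DiffOps

/-! ### Arithmetic of operators over a differential field; existence of common left multiples. -/

section Ore

open scoped Differential

variable {F : Type*} [Field F] [Differential F]

/-! The algorithm is a balanced tournament: the operators are combined in pairs until one is left.
What makes it cheap is a bound on intermediate sizes that depends only on how many inputs `n` a node
stands for. A primitive LCLM of `n` operators of bidegree at most `(d, r)` has order at most `n r`
(dimension count, `exists_common_left_multiple`) and degree at most `d (n + 1) (n r + 1) ≤ 4 n² r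
d`.

The degree bound (`natDegree_coeff_le_of_isLeast`) comes from reading `M = Qᵢ Lᵢ` as a homogeneous
linear system over `K[x]` for the coefficients of `M` and the `Qᵢ`. Its entries have degree at most
`d`, because multiplying by `∂` does not raise degrees in `x`. By `exists_polynomial_kernel_vector`
it has a polynomial solution of small degree. This yields a common left multiple that is a rational
multiple of `M`, and primitivity transfers the bound to `M`.

A level whose nodes stand for at most `n = 2 ^ j` inputs needs at most `k / n` calls, costing about
`(k / n) (n r)^α (4 n² r d)^β`. This is largest at `n = k`, where it is the claimed bound up to
`4^β`. The `log k + 1` levels are absorbed by the soft-O. -/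

theorem dMul_add (P Q : F[X]) : dMul (P + Q) = dMul P + dMul Q := by
  simp only [dMul, map_add]; ring

theorem dMul_C_mul (a : F) (Q : F[X]) : dMul (C a * Q) = C a * dMul Q + C (a′) * Q := by
  simp only [dMul, Derivation.leibniz, Differential.mapCoeffs_C, smul_eq_mul]; ring

theorem dMul_zero : dMul (0 : F[X]) = 0 := by simp [dMul]

theorem dMul_monomial (i : ℕ) (a : F) :
    dMul (monomial i a) = monomial (i + 1) a + monomial i (a′) := by
  simp [dMul, Differential.mapCoeffs_monomial, monomial_mul_X]

/-- Multiplication of operators from the right is linear over the field of coefficients. -/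
def opMulRight (L : F[X]) : F[X] →ₗ[F] F[X] :=
  Polynomial.lsum fun i => LinearMap.toSpanSingleton F F[X] (dMul^[i] L)

theorem opMulRight_apply (L Q : F[X]) : opMulRight L Q = opMul Q L := by
  simp [opMulRight, opMul, Polynomial.lsum_apply, smul_eq_C_mul]

theorem opMul_add_left (P Q L : F[X]) : opMul (P + Q) L = opMul P L + opMul Q L := by
  simp only [← opMulRight_apply, map_add]

theorem opMul_sub_left (P Q L : F[X]) : opMul (P - Q) L = opMul P L - opMul Q L := by
  simp only [← opMulRight_apply, map_sub]

theorem opMul_zero_left (L : F[X]) : opMul 0 L = 0 := by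
  simp only [← opMulRight_apply, map_zero]

theorem opMul_C_mul_left (a : F) (Q L : F[X]) : opMul (C a * Q) L = C a * opMul Q L := by
  simp only [← opMulRight_apply, ← smul_eq_C_mul, map_smul]

theorem opMul_monomial (i : ℕ) (a : F) (L : F[X]) :
    opMul (monomial i a) L = C a * dMul^[i] L := by
  simp [opMul, sum_monomial_index]

theorem opMul_C (a : F) (L : F[X]) : opMul (C a) L = C a * L := by
  simpa using opMul_monomial 0 a L

theorem opMul_one_left (L : F[X]) : opMul 1 L = L := by
  simpa using opMul_C 1 L

/-- The Leibniz rule on coefficients is all that is needed; associativity of the operator product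
follows by iterating this. -/
theorem dMul_opMul (Q L : F[X]) : dMul (opMul Q L) = opMul (dMul Q) L := by
  induction Q using Polynomial.induction_on' with
  | add p q hp hq => simp only [opMul_add_left, dMul_add, hp, hq]
  | monomial i a =>
    rw [dMul_monomial, opMul_add_left, opMul_monomial, opMul_monomial, opMul_monomial,
      dMul_C_mul, Function.iterate_succ_apply']

theorem dMul_iterate_opMul (i : ℕ) (Q L : F[X]) :
    dMul^[i] (opMul Q L) = opMul (dMul^[i] Q) L := by
  induction i with
  | zero => rfl
  | succ i ih => rw [Function.iterate_succ_apply', Function.iterate_succ_apply', ih, dMul_opMul]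

theorem opMul_assoc (P Q L : F[X]) : opMul (opMul P Q) L = opMul P (opMul Q L) := by
  induction P using Polynomial.induction_on' with
  | add p q hp hq => simp only [opMul_add_left, hp, hq]
  | monomial i a => rw [opMul_monomial, opMul_monomial, opMul_C_mul_left, dMul_iterate_opMul]

theorem coeff_dMul_succ (Q : F[X]) (n : ℕ) :
    (dMul Q).coeff (n + 1) = Q.coeff n + (Q.coeff (n + 1))′ := by
  simp [dMul, Differential.coeff_mapCoeffs]

theorem coeff_dMul_iterate_of_lt {L : F[X]} {m : ℕ} (hL : L.natDegree ≤ m) (i : ℕ) {n : ℕ}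
    (hn : m + i < n) : (dMul^[i] L).coeff n = 0 := by
  induction i generalizing n with
  | zero => exact coeff_eq_zero_of_natDegree_lt (by simpa using lt_of_le_of_lt hL hn)
  | succ i ih =>
    obtain ⟨n, rfl⟩ : ∃ k, n = k + 1 := ⟨n - 1, by omega⟩
    rw [Function.iterate_succ_apply', coeff_dMul_succ, ih (by omega), ih (by omega)]
    simp

/-- `∂` shifts coefficients up and adds their derivatives one place lower, so the top one is
unchanged. Hence orders add and there are no zero divisors. -/
theorem coeff_dMul_iterate_add {L : F[X]} {m : ℕ} (hL : L.natDegree ≤ m) (i : ℕ) :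
    (dMul^[i] L).coeff (m + i) = L.coeff m := by
  induction i with
  | zero => rfl
  | succ i ih =>
    rw [Function.iterate_succ_apply', ← add_assoc, coeff_dMul_succ, ih,
      coeff_dMul_iterate_of_lt hL i (by omega)]
    simp

theorem coeff_opMul (Q L : F[X]) (n : ℕ) :
    (opMul Q L).coeff n = Q.sum fun i a => a * (dMul^[i] L).coeff n := by
  simp only [opMul, Polynomial.sum, finsetSum_coeff, coeff_C_mul]

theorem coeff_opMul_range {Q : F[X]} {s : ℕ} (hQ : Q.natDegree < s) (L : F[X]) (n : ℕ) :
    (opMul Q L).coeff n = ∑ i ∈ Finset.range s, Q.coeff i * (dMul^[i] L).coeff n := by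
  rw [coeff_opMul]
  exact Polynomial.sum_over_range' _ (fun _ => by simp) s hQ

theorem coeff_opMul_of_lt {Q L : F[X]} {s m n : ℕ} (hQ : Q.natDegree ≤ s) (hL : L.natDegree ≤ m)
    (hn : s + m < n) : (opMul Q L).coeff n = 0 := by
  rw [coeff_opMul_range (Nat.lt_succ_of_le hQ)]
  refine Finset.sum_eq_zero fun i hi => ?_
  rw [coeff_dMul_iterate_of_lt hL i (by have := Finset.mem_range.1 hi; omega), mul_zero]

theorem coeff_opMul_add {Q L : F[X]} {s m : ℕ} (hQ : Q.natDegree ≤ s) (hL : L.natDegree ≤ m) :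
    (opMul Q L).coeff (s + m) = Q.coeff s * L.coeff m := by
  rw [coeff_opMul_range (Nat.lt_succ_of_le hQ), Finset.sum_range_succ, Finset.sum_eq_zero,
    zero_add, add_comm s m, coeff_dMul_iterate_add hL]
  intro i hi
  rw [coeff_dMul_iterate_of_lt hL i (by have := Finset.mem_range.1 hi; omega), mul_zero]

theorem natDegree_opMul_le {Q L : F[X]} {s m : ℕ} (hQ : Q.natDegree ≤ s)
    (hL : L.natDegree ≤ m) : (opMul Q L).natDegree ≤ s + m :=
  natDegree_le_iff_coeff_eq_zero.2 fun _ hn => coeff_opMul_of_lt hQ hL hn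

theorem coeff_opMul_natDegree (Q L : F[X]) :
    (opMul Q L).coeff (Q.natDegree + L.natDegree) = Q.leadingCoeff * L.leadingCoeff :=
  coeff_opMul_add le_rfl le_rfl

theorem opMul_ne_zero {Q L : F[X]} (hQ : Q ≠ 0) (hL : L ≠ 0) : opMul Q L ≠ 0 := by
  intro h
  have := coeff_opMul_natDegree Q L
  rw [h, coeff_zero] at this
  exact mul_ne_zero (leadingCoeff_ne_zero.2 hQ) (leadingCoeff_ne_zero.2 hL) this.symm

theorem natDegree_opMul {Q L : F[X]} (hQ : Q ≠ 0) (hL : L ≠ 0) :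
    (opMul Q L).natDegree = Q.natDegree + L.natDegree := by
  refine le_antisymm (natDegree_opMul_le le_rfl le_rfl) (le_natDegree_of_ne_zero ?_)
  rw [coeff_opMul_natDegree]
  exact mul_ne_zero (leadingCoeff_ne_zero.2 hQ) (leadingCoeff_ne_zero.2 hL)

/-- Right division with remainder. -/
theorem exists_opMul_sub_degree_lt (P : F[X]) {L : F[X]} (hL : L ≠ 0) :
    ∃ Q, (P - opMul Q L).degree < L.degree := by
  induction hn : P.natDegree using Nat.strong_induction_on generalizing P with
  | _ n ih =>
  by_cases hlt : P.degree < L.degree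
  · exact ⟨0, by simpa [opMul_zero_left] using hlt⟩
  have hP : P ≠ 0 := by
    rintro rfl
    exact hlt (by simpa [bot_lt_iff_ne_bot] using hL)
  have hle : L.natDegree ≤ P.natDegree := natDegree_le_natDegree (not_lt.1 hlt)
  set Q : F[X] := monomial (P.natDegree - L.natDegree) (P.leadingCoeff / L.leadingCoeff) with hQ
  have ha : P.leadingCoeff / L.leadingCoeff ≠ 0 :=
    div_ne_zero (leadingCoeff_ne_zero.2 hP) (leadingCoeff_ne_zero.2 hL)
  have hQ0 : Q ≠ 0 := by simpa [hQ] using ⟨hP, hL⟩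
  have hdQ : Q.natDegree = P.natDegree - L.natDegree := natDegree_monomial_eq _ ha
  have hd : (opMul Q L).natDegree = P.natDegree := by
    rw [natDegree_opMul hQ0 hL, hdQ]; omega
  have hlc : (opMul Q L).leadingCoeff = P.leadingCoeff := by
    have := coeff_opMul_natDegree Q L
    rw [← natDegree_opMul hQ0 hL] at this
    rw [leadingCoeff, this, hQ, leadingCoeff_monomial,
      div_mul_cancel₀ _ (leadingCoeff_ne_zero.2 hL)]
  have hdeg : (P - opMul Q L).degree < P.degree :=
    degree_sub_lt_left (by rw [degree_eq_natDegree hP, degree_eq_natDegree (opMul_ne_zero hQ0 hL), hd])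
      hP hlc.symm
  by_cases h0 : P - opMul Q L = 0
  · exact ⟨Q, by rw [h0]; simpa [bot_lt_iff_ne_bot] using hL⟩
  obtain ⟨Q', hQ'⟩ := ih _ (hn ▸ natDegree_lt_natDegree h0 hdeg) (P - opMul Q L) rfl
  exact ⟨Q + Q', by rwa [opMul_add_left, ← sub_sub]⟩

/-- `L` divides `P` from the right. -/
def RightDvd (L P : F[X]) : Prop := ∃ Q, P = opMul Q L

theorem RightDvd.refl (L : F[X]) : RightDvd L L := ⟨1, (opMul_one_left L).symm⟩

theorem RightDvd.trans {L M P : F[X]} (h : RightDvd L M) (h' : RightDvd M P) : RightDvd L P := by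
  obtain ⟨Q, rfl⟩ := h
  obtain ⟨Q', rfl⟩ := h'
  exact ⟨opMul Q' Q, (opMul_assoc _ _ _).symm⟩

theorem RightDvd.sub {L P P' : F[X]} (h : RightDvd L P) (h' : RightDvd L P') :
    RightDvd L (P - P') := by
  obtain ⟨Q, rfl⟩ := h
  obtain ⟨Q', rfl⟩ := h'
  exact ⟨Q - Q', (opMul_sub_left _ _ _).symm⟩

/-- A common left multiple of least order divides every common left multiple from the right. -/
theorem rightDvd_of_minimal {ι : Type*} {L : ι → F[X]} {M : F[X]} (hM0 : M ≠ 0)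
    (hM : ∀ i, RightDvd (L i) M)
    (hmin : ∀ M', M' ≠ 0 → (∀ i, RightDvd (L i) M') → M.natDegree ≤ M'.natDegree)
    {P : F[X]} (hP : ∀ i, RightDvd (L i) P) : RightDvd M P := by
  obtain ⟨Q, hQ⟩ := exists_opMul_sub_degree_lt P hM0
  refine ⟨Q, sub_eq_zero.1 ?_⟩
  by_contra h0
  have := hmin _ h0 fun i => (hP i).sub ((hM i).trans ⟨Q, rfl⟩)
  exact absurd (natDegree_lt_natDegree h0 hQ) (not_lt.2 this)

theorem mem_degreeLT_succ {R : Type*} [CommRing R] {n : ℕ} {p : R[X]} :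
    p ∈ degreeLT R (n + 1) ↔ p.natDegree ≤ n := by
  rw [degreeLT_succ_eq_degreeLE, mem_degreeLE, natDegree_le_iff_degree_le]

theorem finrank_degreeLT (R : Type*) [Field R] (n : ℕ) : Module.finrank R (degreeLT R n) = n := by
  rw [(degreeLTEquiv R n).finrank_eq, Module.finrank_fin_fun]

instance finiteDimensional_degreeLT (R : Type*) [Field R] (n : ℕ) :
    FiniteDimensional R (degreeLT R n) :=
  (degreeLTEquiv R n).symm.finiteDimensional

/-- Common left multiples exist, with order at most the sum of the orders. -/
theorem exists_common_left_multiple {ι : Type*} [Fintype ι] {L : ι → F[X]} (hL : ∀ i, L i ≠ 0) :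
    ∃ M, M ≠ 0 ∧ (∀ i, RightDvd (L i) M) ∧ M.natDegree ≤ ∑ i, (L i).natDegree := by
  set s := ∑ i, (L i).natDegree with hs
  have hle (i : ι) : (L i).natDegree ≤ s :=
    Finset.single_le_sum (f := fun i => (L i).natDegree) (fun _ _ => Nat.zero_le _)
      (Finset.mem_univ i)
  -- Unknowns: a multiple `M` of order at most `s` and cofactors `Qᵢ` of order at most `s - ord Lᵢ`.
  -- The map `φ` below sends them to the family `M - Qᵢ Lᵢ`.
  let V := degreeLT F (s + 1) × ((i : ι) → degreeLT F (s - (L i).natDegree + 1))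
  have hmem (i : ι) (v : V) : (v.1 : F[X]) - opMulRight (L i) (v.2 i : F[X]) ∈
      degreeLT F (s + 1) := by
    refine Submodule.sub_mem _ v.1.2 ?_
    rw [opMulRight_apply, mem_degreeLT_succ]
    have := natDegree_opMul_le (mem_degreeLT_succ.1 (v.2 i).2) (le_refl (L i).natDegree)
    have := hle i
    omega
  let φ : V →ₗ[F] (ι → degreeLT F (s + 1)) := LinearMap.pi fun i =>
    LinearMap.codRestrict _ ((Submodule.subtype _).comp (LinearMap.fst F _ _) -
      (opMulRight (L i)).comp ((Submodule.subtype _).comp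
        ((LinearMap.proj i).comp (LinearMap.snd F _ _)))) fun v => hmem i v
  have hker : LinearMap.ker φ ≠ ⊥ := by
    refine φ.ker_ne_bot_of_finrank_lt ?_
    simp only [V, Module.finrank_prod, Module.finrank_pi_fintype, finrank_degreeLT]
    -- There is exactly one more unknown than there are equations.
    have h : ∑ i, (s - (L i).natDegree + 1) + s = ∑ _i : ι, (s + 1) := by
      rw [hs, ← Finset.sum_add_distrib]
      refine Finset.sum_congr rfl fun i _ => ?_
      have := hle i
      omega
    omega
  obtain ⟨v, hv, hv0⟩ := (Submodule.ne_bot_iff _).1 hker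
  have hφ (i : ι) : (v.1 : F[X]) = opMul (v.2 i : F[X]) (L i) := by
    have := congrArg (Subtype.val) (congrFun (LinearMap.mem_ker.1 hv) i)
    rw [← opMulRight_apply]
    exact sub_eq_zero.1 this
  refine ⟨v.1, fun h0 => hv0 ?_, fun i => ⟨_, hφ i⟩, mem_degreeLT_succ.1 v.1.2⟩
  refine Prod.ext (Subtype.ext h0) (funext fun i => Subtype.ext ?_)
  by_contra hne
  exact opMul_ne_zero hne (hL i) ((hφ i).symm.trans h0)

end Ore

/-! ### Polynomial kernel vectors of small degree. -/

section Kernel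

variable {K : Type*} [Field K]

/-- A matrix of polynomials which is singular over the field of rational functions has a nonzero
polynomial vector of controlled degree in its kernel. -/
theorem exists_polynomial_kernel_vector {ι κ : Type*} [Fintype κ] (A : ι → κ → K[X]) (d : ℕ)
    (hA : ∀ i j, (A i j).natDegree ≤ d) (v : κ → RatFunc K) (hv0 : v ≠ 0)
    (hv : ∀ i, ∑ j, algebraMap K[X] (RatFunc K) (A i j) * v j = 0) :
    ∃ w : κ → K[X], w ≠ 0 ∧ (∀ j, (w j).natDegree ≤ d * Fintype.card κ) ∧
      ∀ i, ∑ j, A i j * w j = 0 := by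
  classical
  set a : ι → κ → RatFunc K := fun i j => algebraMap K[X] (RatFunc K) (A i j) with ha
  -- There may be infinitely many rows; a basis `b` of their span carries all the equations. It has
  -- fewer than `card κ` elements because `v` is orthogonal to every row.
  obtain ⟨b, hb, hspan, hli⟩ := exists_linearIndependent (RatFunc K) (Set.range a)
  have hfin : b.Finite := hli.setFinite
  have : Fintype b := hfin.fintype
  have hcard : Fintype.card b < Fintype.card κ := by
    rw [← Set.toFinset_card, ← finrank_span_set_eq_card hli, hspan, ← Module.finrank_fintype_fun_eq_card (RatFunc K)]
    refine Submodule.finrank_lt fun htop => hv0 ?_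
    let f : (κ → RatFunc K) →ₗ[RatFunc K] RatFunc K := Fintype.linearCombination _ v
    have hf : Submodule.span (RatFunc K) (Set.range a) ≤ LinearMap.ker f := by
      rw [Submodule.span_le]
      rintro _ ⟨i, rfl⟩
      simpa [f, Fintype.linearCombination_apply] using hv i
    rw [htop] at hf
    funext j
    have := LinearMap.mem_ker.1 (hf (Submodule.mem_top (x := Pi.single j 1)))
    simpa [f, Fintype.linearCombination_apply, Pi.single_apply] using this
  choose r hr using fun x : b => hb x.2
  -- With degrees up to `e` there are `card κ * (e + 1)` unknowns in `K` against `card b * (e + d +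
  -- 1)` equations; `d * card b ≤ e` makes the unknowns prevail.
  set e := d * Fintype.card κ with he
  have hmem (x : b) (w : κ → degreeLT K (e + 1)) :
      ∑ j, A (r x) j * (w j : K[X]) ∈ degreeLT K (e + d + 1) := by
    refine Submodule.sum_mem _ fun j _ => ?_
    rw [mem_degreeLT_succ]
    have h1 := mem_degreeLT_succ.1 (w j).2
    have h2 := hA (r x) j
    have h3 := natDegree_mul_le (p := A (r x) j) (q := (w j : K[X]))
    omega
  let φ : (κ → degreeLT K (e + 1)) →ₗ[K] (b → degreeLT K (e + d + 1)) :=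
    { toFun := fun w x => ⟨_, hmem x w⟩
      map_add' := fun w w' => by
        ext1 x; apply Subtype.ext; simp [mul_add, Finset.sum_add_distrib]
      map_smul' := fun c w => by
        ext1 x; apply Subtype.ext; simp [Finset.smul_sum] }
  have hker : LinearMap.ker φ ≠ ⊥ := by
    refine φ.ker_ne_bot_of_finrank_lt ?_
    simp only [Module.finrank_pi_fintype, finrank_degreeLT, Finset.sum_const, Finset.card_univ,
      smul_eq_mul]
    calc Fintype.card b * (e + d + 1) = Fintype.card b * (e + 1) + d * Fintype.card b := by ring
      _ < Fintype.card b * (e + 1) + (e + 1) := by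
          have : d * Fintype.card b ≤ e := Nat.mul_le_mul_left _ hcard.le
          omega
      _ = (Fintype.card b + 1) * (e + 1) := by ring
      _ ≤ _ := Nat.mul_le_mul_right _ hcard
  obtain ⟨w, hw, hw0⟩ := (Submodule.ne_bot_iff _).1 hker
  refine ⟨fun j => w j, fun h => hw0 (funext fun j => Subtype.ext (congrFun h j)),
    fun j => mem_degreeLT_succ.1 (w j).2, fun i => ?_⟩
  let f : (κ → RatFunc K) →ₗ[RatFunc K] RatFunc K :=
    Fintype.linearCombination _ fun j => algebraMap K[X] (RatFunc K) (w j)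
  have hf : Submodule.span (RatFunc K) (Set.range a) ≤ LinearMap.ker f := by
    rw [← hspan, Submodule.span_le]
    intro x hx
    have h := congrArg Subtype.val (congrFun (LinearMap.mem_ker.1 hw) ⟨x, hx⟩)
    replace h := congrArg (algebraMap K[X] (RatFunc K)) h
    have hx' := hr ⟨x, hx⟩
    simp only at hx'
    rw [← hx']
    simpa [φ, f, Fintype.linearCombination_apply, ha] using h
  have := LinearMap.mem_ker.1 (hf (Submodule.subset_span ⟨i, rfl⟩))
  apply RatFunc.algebraMap_injective K
  simpa [f, Fintype.linearCombination_apply, ha] using this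

end Kernel

/-! ### Bidegree of least common left multiples. -/

section Multiples

variable {K : Type*} [Field K]

theorem coeff_toRat (L : K[X][X]) (n : ℕ) :
    (toRat L).coeff n = algebraMap K[X] (RatFunc K) (L.coeff n) := by
  simp [toRat]

theorem natDegree_toRat (L : K[X][X]) : (toRat L).natDegree = L.natDegree :=
  natDegree_map_eq_of_injective (RatFunc.algebraMap_injective K) L

theorem toRat_ne_zero {L : K[X][X]} (hL : L ≠ 0) : toRat L ≠ 0 :=
  (Polynomial.map_ne_zero_iff (RatFunc.algebraMap_injective K)).2 hL

open scoped Differential in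
theorem deriv_algebraMap (p : K[X]) : (algebraMap K[X] (RatFunc K) p)′ =
    algebraMap K[X] (RatFunc K) (derivative p) := by
  change ratDeriv _ = _
  simpa using ratDeriv_div p 1 one_ne_zero

theorem BidegreeLE.mono {d d' r r' : ℕ} (hd : d ≤ d') (hr : r ≤ r') {L : K[X][X]}
    (h : BidegreeLE d r L) : BidegreeLE d' r' L :=
  ⟨h.1.trans hr, fun i => (h.2 i).trans hd⟩

/-- Multiplication by powers of `∂` does not increase the degrees of the coefficients. -/
theorem exists_toRat_eq_dMul_iterate {d : ℕ} {L : K[X][X]}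
    (hL : ∀ i, (L.coeff i).natDegree ≤ d) (j : ℕ) :
    ∃ L' : K[X][X], toRat L' = dMul^[j] (toRat L) ∧ ∀ i, (L'.coeff i).natDegree ≤ d := by
  induction j with
  | zero => exact ⟨L, rfl, hL⟩
  | succ j ih =>
    obtain ⟨L', h, hd⟩ := ih
    rw [Function.iterate_succ_apply', ← h]
    -- `d/dx` on `K[x]` lets `dMul` be formed before passing to `K(x)`.
    let _ : Differential K[X] := ⟨(derivative' (R := K)).restrictScalars ℤ⟩
    have hder (p : K[X]) : Differential.deriv p = derivative p := rfl
    refine ⟨dMul L', ?_, ?_⟩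
    · ext1 i
      cases i with
      | zero => simp [coeff_toRat, deriv_algebraMap, dMul,
          Differential.coeff_mapCoeffs, hder]
      | succ i => simp [coeff_toRat, deriv_algebraMap, dMul,
          Differential.coeff_mapCoeffs, hder]
    · intro i
      have h' (n : ℕ) : (derivative (L'.coeff n)).natDegree ≤ d :=
        (natDegree_derivative_le _).trans ((Nat.sub_le _ _).trans (hd n))
      cases i with
      | zero => simpa [dMul, Differential.coeff_mapCoeffs, hder] using h' 0
      | succ i =>
        simp only [dMul, coeff_add, coeff_mul_X, Differential.coeff_mapCoeffs, hder]
        exact (natDegree_add_le _ _).trans (max_le (hd i) (h' (i + 1)))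

/-- If `M` is primitive and `P` is a multiple of `M` over the field of rational functions, then the
coefficients of `M` have no larger degrees than those of `P`. -/
theorem natDegree_coeff_le_of_isPrimitive {M P : K[X][X]} (hM : M.IsPrimitive) (hP : P ≠ 0)
    {q : RatFunc K} (h : toRat P = C q * toRat M) (c : ℕ) :
    (M.coeff c).natDegree ≤ (P.coeff c).natDegree := by
  have hb0 : algebraMap K[X] (RatFunc K) q.denom ≠ 0 :=
    RatFunc.algebraMap_ne_zero q.denom_ne_zero
  have hq : q ≠ 0 := by
    rintro rfl
    exact toRat_ne_zero hP (by simpa using h)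
  have key (n : ℕ) : q.denom * P.coeff n = q.num * M.coeff n := by
    apply RatFunc.algebraMap_injective K
    have h1 := congrArg (fun p => p.coeff n) h
    simp only [coeff_toRat, coeff_C_mul] at h1
    rw [map_mul, map_mul, h1, ← mul_assoc]
    congr 1
    have h2 := q.num_div_denom
    rwa [div_eq_iff hb0, mul_comm, eq_comm] at h2
  -- The denominator is coprime to the numerator, so it divides every coefficient of the primitive
  -- `M`.
  have hu : IsUnit q.denom := by
    refine hM _ ((C_dvd_iff_dvd_coeff _ _).2 fun n => ?_)
    exact (RatFunc.isCoprime_num_denom q).symm.dvd_of_dvd_mul_left ⟨_, (key n).symm⟩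
  by_cases h0 : M.coeff c = 0
  · simp [h0]
  have h2 := congrArg natDegree (key c)
  rw [natDegree_mul (RatFunc.num_ne_zero hq) h0] at h2
  have h3 := natDegree_mul_le (p := q.denom) (q := P.coeff c)
  rw [natDegree_eq_zero_of_isUnit hu] at h3
  omega

/-- A primitive common left multiple which divides all others has coefficients of bounded
degree. -/
theorem natDegree_coeff_le_of_isLeast {ι : Type*} [Fintype ι] {L : ι → K[X][X]} {M : K[X][X]}
    {d m : ℕ} (hL0 : ∀ i, L i ≠ 0) (hd : ∀ i c, ((L i).coeff c).natDegree ≤ d)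
    (hM : M.IsPrimitive) (hm : M.natDegree = m) (hmul : ∀ i, RightDvd (toRat (L i)) (toRat M))
    (hleast : ∀ P, (∀ i, RightDvd (toRat (L i)) P) → RightDvd (toRat M) P) (c : ℕ) :
    (M.coeff c).natDegree ≤ d * ((Fintype.card ι + 1) * (m + 1)) := by
  classical
  have hM0 : M ≠ 0 := hM.ne_zero
  choose D hD hDd using fun i (j : ℕ) => exists_toRat_eq_dMul_iterate (hd i) j
  choose Q hQ using hmul
  have hQ0 (i : ι) : Q i ≠ 0 := by
    intro h
    have := hQ i
    rw [h, opMul_zero_left] at this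
    exact toRat_ne_zero hM0 this
  have hQm (i : ι) : (Q i).natDegree < m + 1 := by
    have := natDegree_opMul (hQ0 i) (toRat_ne_zero (hL0 i))
    rw [← hQ i, natDegree_toRat] at this
    omega
  -- Row `(i, n)` compares the coefficients of `∂ⁿ` in `M = Qᵢ Lᵢ`. Column `(none, j)` is the `j`-th
  -- coefficient of `M`, column `(some i, j)` that of `Qᵢ`; `D i j` is `∂ʲ Lᵢ`.
  let A : ι × ℕ → Option ι × Fin (m + 1) → K[X] := fun x y =>
    y.1.elim (if (y.2 : ℕ) = x.2 then 1 else 0)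
      (fun i => if i = x.1 then -(D x.1 y.2).coeff x.2 else 0)
  let v : Option ι × Fin (m + 1) → RatFunc K := fun y =>
    y.1.elim ((toRat M).coeff y.2) (fun i => (Q i).coeff y.2)
  -- A general `f` serves both the given solution over `K(x)` and the polynomial solution found
  -- below.
  have hsum {R : Type _} [CommRing R] (f : K[X] →+* R) (u : Option ι × Fin (m + 1) → R) (i : ι)
      (n : ℕ) : ∑ y, f (A (i, n) y) * u y = (∑ j : Fin (m + 1), if (j : ℕ) = n then u (none, j)
        else 0) - ∑ j : Fin (m + 1), u (some i, j) * f ((D i j).coeff n) := by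
    rw [Fintype.sum_prod_type, Fintype.sum_option, Finset.sum_eq_single i, sub_eq_add_neg,
      ← Finset.sum_neg_distrib]
    · congr 1
      · refine Finset.sum_congr rfl fun j _ => ?_
        by_cases h : (j : ℕ) = n <;> simp [A, h]
      · refine Finset.sum_congr rfl fun j _ => ?_
        simp [A, mul_comm]
    · intro i' _ hi'
      simp [A, hi']
    · simp
  have hv0 : v ≠ 0 := by
    intro h
    have h1 := congrFun h (none, ⟨m, Nat.lt_succ_self m⟩)
    have h2 : (toRat M).coeff m = 0 := h1
    rw [← hm, ← natDegree_toRat, coeff_natDegree, leadingCoeff_eq_zero] at h2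
    exact toRat_ne_zero hM0 h2
  have hv (x : ι × ℕ) : ∑ y, algebraMap K[X] (RatFunc K) (A x y) * v y = 0 := by
    rw [hsum, sub_eq_zero]
    have h1 : ∑ j : Fin (m + 1), (if (j : ℕ) = x.2 then v (none, j) else 0) =
        (toRat M).coeff x.2 := by
      change ∑ j : Fin (m + 1), (if (j : ℕ) = x.2 then (toRat M).coeff j else 0) = _
      rw [Fin.sum_univ_eq_sum_range (fun j => if j = x.2 then (toRat M).coeff j else 0) (m + 1),
        Finset.sum_ite_eq']
      split_ifs with h
      · rfl
      · refine (coeff_eq_zero_of_natDegree_lt ?_).symm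
        rw [natDegree_toRat, hm]
        simpa [Nat.lt_succ_iff] using h
    rw [h1, hQ x.1, coeff_opMul_range (hQm x.1), ← Fin.sum_univ_eq_sum_range
      (fun j => (Q x.1).coeff j * (dMul^[j] (toRat (L x.1))).coeff x.2) (m + 1)]
    refine Finset.sum_congr rfl fun j _ => ?_
    rw [← hD, coeff_toRat]
    rfl
  have hA (x : ι × ℕ) (y : Option ι × Fin (m + 1)) : (A x y).natDegree ≤ d := by
    obtain ⟨_ | i, j⟩ := y
    · simp only [A, Option.elim]
      split_ifs <;> simp
    · simp only [A, Option.elim]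
      split_ifs <;> simp [hDd]
  obtain ⟨w, hw0, hwd, hw⟩ := exists_polynomial_kernel_vector A d hA v hv0 hv
  have hcoeff {R : Type _} [CommRing R] (u : Fin (m + 1) → R) (n : ℕ) :
      (∑ j : Fin (m + 1), monomial (j : ℕ) (u j)).coeff n =
        ∑ j : Fin (m + 1), if (j : ℕ) = n then u j else 0 := by
    simp [finsetSum_coeff, coeff_monomial]
  have hcoeff' {R : Type _} [CommRing R] (u : Fin (m + 1) → R) (j : Fin (m + 1)) :
      (∑ j : Fin (m + 1), monomial (j : ℕ) (u j)).coeff j = u j := by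
    simp [finsetSum_coeff, coeff_monomial, Fin.val_inj]
  have hdeg {R : Type _} [CommRing R] (u : Fin (m + 1) → R) :
      (∑ j : Fin (m + 1), monomial (j : ℕ) (u j)).natDegree ≤ m :=
    natDegree_sum_le_of_forall_le _ _ fun j _ =>
      (natDegree_monomial_le _).trans (Nat.le_of_lt_succ j.2)
  set P : K[X][X] := ∑ j : Fin (m + 1), monomial (j : ℕ) (w (none, j)) with hP
  let Q' : ι → (RatFunc K)[X] := fun i =>
    ∑ j : Fin (m + 1), monomial (j : ℕ) (algebraMap K[X] (RatFunc K) (w (some i, j)))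
  have hPQ (i : ι) : toRat P = opMul (Q' i) (toRat (L i)) := by
    ext1 n
    rw [coeff_toRat, hP, hcoeff, coeff_opMul_range (Nat.lt_succ_of_le (hdeg _)),
      ← Fin.sum_univ_eq_sum_range
        (fun j => (Q' i).coeff j * (dMul^[j] (toRat (L i))).coeff n) (m + 1)]
    have h := hw (i, n)
    have h' := hsum (RingHom.id _) w i n
    simp only [RingHom.id_apply] at h'
    rw [h', sub_eq_zero] at h
    rw [h, map_sum]
    refine Finset.sum_congr rfl fun j _ => ?_
    rw [← hD, coeff_toRat, map_mul, hcoeff']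
  -- If `P` vanished, so would every cofactor, as there are no zero divisors, and then `w = 0`.
  have hP0 : P ≠ 0 := by
    intro h0
    refine hw0 (funext fun y => ?_)
    obtain ⟨_ | i, j⟩ := y
    · have := hcoeff' (fun j => w (none, j)) j
      rw [← hP, h0] at this
      exact this.symm
    · have h1 : Q' i = 0 := by
        by_contra hne
        refine opMul_ne_zero hne (toRat_ne_zero (hL0 i)) ?_
        rw [← hPQ i, h0]
        simp [toRat]
      have := hcoeff' (fun j => algebraMap K[X] (RatFunc K) (w (some i, j))) j
      change (Q' i).coeff j = _ at this
      rw [h1, coeff_zero] at this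
      exact (map_eq_zero_iff _ (RatFunc.algebraMap_injective K)).1 this.symm
  obtain ⟨q, hq⟩ := hleast (toRat P) fun i => ⟨_, hPQ i⟩
  have hq0 : q ≠ 0 := by
    rintro rfl
    rw [opMul_zero_left] at hq
    exact toRat_ne_zero hP0 hq
  -- `P` has order at most `m`, the order of `M`, so the quotient is a rational function.
  have hqd : q.natDegree = 0 := by
    have := natDegree_opMul hq0 (toRat_ne_zero hM0)
    rw [← hq, natDegree_toRat, natDegree_toRat] at this
    have : P.natDegree ≤ m := hdeg fun j => w (none, j)
    omega
  rw [eq_C_of_natDegree_eq_zero hqd, opMul_C] at hq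
  refine (natDegree_coeff_le_of_isPrimitive hM hP0 hq c).trans ?_
  rw [hP, hcoeff]
  refine natDegree_sum_le_of_forall_le _ _ fun j _ => ?_
  split_ifs
  · simpa using hwd (none, j)
  · simp

/-- The right multiples of `M` are the common ones of the `L i` with `i ∈ S`. -/
def Represents {ι : Type*} (L : ι → K[X][X]) (S : Finset ι) (M : K[X][X]) : Prop :=
  ∀ P, RightDvd (toRat M) P ↔ ∀ i ∈ S, RightDvd (toRat (L i)) P

theorem represents_singleton {ι : Type*} (L : ι → K[X][X]) (i : ι) : Represents L {i} (L i) := by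
  simp [Represents]

/-- A least common left multiple right-divides all common left multiples, so the conditions for `S`
and `S'` are simply conjoined; overlaps are harmless. -/
theorem IsPrimitiveLCLM.represents_union {ι : Type*} [DecidableEq ι] {L : ι → K[X][X]}
    {S S' : Finset ι} {M M' N : K[X][X]} (h : Represents L S M) (h' : Represents L S' M')
    (hN : IsPrimitiveLCLM ![M, M'] N) : Represents L (S ∪ S') N := by
  intro P
  obtain ⟨⟨hN0, hdvd⟩, hmin, -⟩ := hN
  have key : RightDvd (toRat N) P ↔ ∀ i, RightDvd (toRat (![M, M'] i)) P :=
    ⟨fun hP i => RightDvd.trans (hdvd i) hP, fun hP => rightDvd_of_minimal hN0 hdvd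
      (fun M'' h0 hM'' => by rw [natDegree_toRat]; exact hmin M'' ⟨h0, hM''⟩) hP⟩
  rw [key, Fin.forall_fin_two]
  simp only [Matrix.cons_val_zero, Matrix.cons_val_one]
  rw [h P, h' P]
  simp only [Finset.mem_union, or_imp, forall_and]

/-- The bidegree of a primitive least common left multiple of operators of bidegree at most
`(d, r)`. -/
theorem Represents.bidegreeLE {ι : Type*} {L : ι → K[X][X]} {S : Finset ι} {M : K[X][X]}
    (h : Represents L S M) (hM : M.IsPrimitive) (hL0 : ∀ i, L i ≠ 0) {d r : ℕ}
    (hL : ∀ i, BidegreeLE d r (L i)) :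
    BidegreeLE (d * ((S.card + 1) * (S.card * r + 1))) (S.card * r) M := by
  have hM0 : M ≠ 0 := hM.ne_zero
  have horder : M.natDegree ≤ S.card * r := by
    obtain ⟨P, hP0, hP, hdeg⟩ :=
      exists_common_left_multiple (L := fun i : S => toRat (L i)) fun i => toRat_ne_zero (hL0 i)
    obtain ⟨Q, rfl⟩ := (h P).2 fun i hi => hP ⟨i, hi⟩
    have hQ0 : Q ≠ 0 := by
      rintro rfl
      exact hP0 (opMul_zero_left _)
    rw [natDegree_opMul hQ0 (toRat_ne_zero hM0), natDegree_toRat] at hdeg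
    refine (Nat.le_add_left _ _).trans (hdeg.trans ?_)
    refine (Finset.sum_le_card_nsmul _ _ r fun i _ => ?_).trans (by simp)
    rw [natDegree_toRat]
    exact (hL i).1
  refine ⟨horder, fun c => ?_⟩
  refine (natDegree_coeff_le_of_isLeast (L := fun i : S => L i) (d := d) (fun i => hL0 i)
    (fun i => (hL i).2) hM rfl (fun i => ?_) (fun P hP => ?_) c).trans ?_
  · exact (h _).1 (RightDvd.refl _) i i.2
  · exact (h P).2 fun i hi => hP ⟨i, hi⟩
  · rw [Fintype.card_coe]
    gcongr

theorem Represents.isPrimitiveLCLM {k : ℕ} {L : Fin k → K[X][X]} {M : K[X][X]}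
    (h : Represents L Finset.univ M) (hM : M.IsPrimitive) : IsPrimitiveLCLM L M := by
  refine ⟨⟨toRat_ne_zero hM.ne_zero, fun i => (h _).1 (RightDvd.refl _) i (Finset.mem_univ i)⟩,
    fun M' hM' => ?_, hM⟩
  obtain ⟨Q, hQ⟩ := (h M').2 fun i _ => hM'.2 i
  have hQ0 : Q ≠ 0 := by
    rintro rfl
    exact hM'.1 (hQ.trans (opMul_zero_left _))
  rw [hQ, natDegree_opMul hQ0 (toRat_ne_zero hM.ne_zero), natDegree_toRat]
  exact Nat.le_add_left _ _

end Multiples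

/-! ### The tournament program: correctness and operation count. -/

section Programs

variable {K : Type*} [Field K]

theorem Eval.cast {P : Prog K} {v w : Data K} {t t' : ℕ} (h : Eval P v w t) (ht : t = t') :
    Eval P v w t' := ht ▸ h

/-- The first operator of the list that remains to be processed is moved to the output. -/
def moveStep : Prog K :=
  .pair (.const .nil) (.pair (.comp .fst .fst) .snd)

/-- The first two operators of the list that remains to be processed are combined. -/
def combineStep (A : Prog K) : Prog K :=
  .pair (.comp .snd (.comp .snd .fst))
    (.pair (.comp A (.pair (.comp .fst .fst) (.pair (.comp .fst (.comp .snd .fst)) (.const .nil))))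
      .snd)

/-- The loop which combines the operators of a list in pairs. -/
def pairingLoop (A : Prog K) : Prog K :=
  .loop .fst (.ifNil (.comp .snd .fst) moveStep (combineStep A))

/-- The program which combines the operators of a list in pairs. -/
def pairingPass (A : Prog K) : Prog K :=
  .comp .snd (.comp (pairingLoop A) (.pair .id (.const .nil)))

/-- Combination in pairs is repeated until there is a single operator left. -/
def tournament (A : Prog K) : Prog K :=
  .loop .snd (pairingPass A)

/-- The program computing the least common left multiple of any number of operators by binary
splitting, from a program for two operators. The last step makes the result primitive. -/
def manyLCLM (A : Prog K) : Prog K :=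
  .comp A (.comp (.pair .fst (.pair .fst (.const .nil))) (tournament A))

theorem eval_moveStep (x y : Data K) :
    Eval moveStep (.pair (.pair x .nil) y) (.pair .nil (.pair x y)) 0 :=
  .pair (.const _ _) (.pair (.comp (.fst _ _) (.fst _ _)) (.snd _ _))

theorem eval_combineStep {A : Prog K} {x y z : Data K} {t : ℕ}
    (h : Eval A (.pair x (.pair y .nil)) z t) (l acc : Data K) :
    Eval (combineStep A) (.pair (.pair x (.pair y l)) acc) (.pair l (.pair z acc)) t :=
  (Eval.pair (.comp (.comp (.fst _ _) (.snd _ _)) (.snd _ _))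
    (.pair (.comp (.pair (.comp (.fst _ _) (.fst _ _))
      (.pair (.comp (.comp (.fst _ _) (.snd _ _)) (.fst _ _)) (.const _ _))) h)
      (.snd _ _))).cast (by omega)

variable {k : ℕ} {L : Fin k → K[X][X]} {d r : ℕ}

/-- The list of operators in a list of operators labelled by sets of indices. -/
def encodeList (l : List (Finset (Fin k) × K[X][X])) : Data K :=
  Data.ofList (l.map fun p => encodeOp p.2)

/-- The operator `p.2` represents the common left multiples of the `L i` with `i ∈ p.1`, there are
at most `n` such `i`, and the bidegree of `p.2` is bounded accordingly. -/
structure IsPartialLCLM (L : Fin k → K[X][X]) (d r n : ℕ) (p : Finset (Fin k) × K[X][X]) :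
    Prop where
  ne_zero : p.2 ≠ 0
  represents : Represents L p.1 p.2
  card_le : p.1.card ≤ n
  bidegreeLE : BidegreeLE (d * ((p.1.card + 1) * (p.1.card * r + 1))) (p.1.card * r) p.2

theorem IsPartialLCLM.mono {n m : ℕ} (h : n ≤ m) {p : Finset (Fin k) × K[X][X]}
    (hp : IsPartialLCLM L d r n p) : IsPartialLCLM L d r m p :=
  ⟨hp.1, hp.2, hp.3.trans h, hp.4⟩

/-- The cost of combining two operators that stand for at most `n` operators each. -/
def combineCost (T : ℕ → ℕ → ℕ) (d r n : ℕ) : ℕ :=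
  T (4 * n ^ 2 * r * d) (n * r)

/-- As `n, r ≥ 1`, both `card + 1 ≤ 2 n` and `card * r + 1 ≤ 2 n r`, whence the factor 4. A monomial
bound is convenient for the cost estimate. -/
theorem IsPartialLCLM.bidegreeLE_of_pos {n : ℕ} {p : Finset (Fin k) × K[X][X]}
    (hp : IsPartialLCLM L d r n p) (hr : 1 ≤ r) (hn : 1 ≤ n) :
    BidegreeLE (4 * n ^ 2 * r * d) (n * r) p.2 := by
  refine hp.bidegreeLE.mono ?_ (Nat.mul_le_mul_right _ hp.card_le)
  have h1 : p.1.card + 1 ≤ 2 * n := by have := hp.card_le; omega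
  have h2 : p.1.card * r + 1 ≤ 2 * (n * r) := by
    have h3 := Nat.mul_le_mul_right r hp.card_le
    have h4 : 1 ≤ n * r := Nat.mul_pos hn hr
    omega
  calc d * ((p.1.card + 1) * (p.1.card * r + 1)) ≤ d * ((2 * n) * (2 * (n * r))) := by gcongr
    _ = 4 * n ^ 2 * r * d := by ring

theorem encodeOps_pair (M N : K[X][X]) :
    encodeOps ![M, N] = .pair (encodeOp M) (.pair (encodeOp N) .nil) := by
  simp [encodeOps, List.ofFn_succ, Data.ofList]

/-- The new bidegree bound is derived afresh from the original inputs in the united index set, not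
from the bounds for `p` and `q`, so nothing compounds over the levels. -/
theorem exists_combine {A : Prog K} {T : ℕ → ℕ → ℕ} (hA : ComputesLCLM A 2 T) (hL0 : ∀ i, L i ≠ 0)
    (hL : ∀ i, BidegreeLE d r (L i)) (hr : 1 ≤ r) {n : ℕ} (hn : 1 ≤ n)
    {p q : Finset (Fin k) × K[X][X]} (hp : IsPartialLCLM L d r n p)
    (hq : IsPartialLCLM L d r n q) :
    ∃ (N : K[X][X]) (t : ℕ), IsPartialLCLM L d r (2 * n) (p.1 ∪ q.1, N) ∧ N.IsPrimitive ∧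
      Eval A (.pair (encodeOp p.2) (.pair (encodeOp q.2) .nil)) (encodeOp N) t ∧
      t ≤ combineCost T d r n := by
  obtain ⟨N, t, hN, hev, ht⟩ := hA (4 * n ^ 2 * r * d) (n * r) ![p.2, q.2]
    (by simp [Fin.forall_fin_two, hp.ne_zero, hq.ne_zero])
    (by simp [Fin.forall_fin_two, hp.bidegreeLE_of_pos hr hn, hq.bidegreeLE_of_pos hr hn])
  rw [encodeOps_pair] at hev
  have hrep := hN.represents_union hp.represents hq.represents
  refine ⟨N, t, ⟨hN.2.2.ne_zero, hrep, ?_, hrep.bidegreeLE hN.2.2 hL0 hL⟩, hN.2.2, hev, ht⟩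
  have h1 := Finset.card_union_le p.1 q.1
  have h2 := hp.card_le
  have h3 := hq.card_le
  dsimp only
  omega

/-- Induction removing two entries at a time. The accumulator reverses the order, which is
immaterial: only coverage of the index sets matters. -/
theorem exists_eval_pairingLoop {A : Prog K} {T : ℕ → ℕ → ℕ} (hA : ComputesLCLM A 2 T)
    (hL0 : ∀ i, L i ≠ 0) (hL : ∀ i, BidegreeLE d r (L i)) (hr : 1 ≤ r) {n : ℕ} (hn : 1 ≤ n) :
    ∀ l acc : List (Finset (Fin k) × K[X][X]), (∀ p ∈ l, IsPartialLCLM L d r n p) →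
      (∀ p ∈ acc, IsPartialLCLM L d r (2 * n) p) →
      ∃ (out : List (Finset (Fin k) × K[X][X])) (t : ℕ),
        (∀ p ∈ out, IsPartialLCLM L d r (2 * n) p) ∧
        (∀ p, p ∈ l ∨ p ∈ acc → ∃ q ∈ out, p.1 ⊆ q.1) ∧
        out.length = acc.length + (l.length + 1) / 2 ∧
        Eval (pairingLoop A) (.pair (encodeList l) (encodeList acc))
          (.pair .nil (encodeList out)) t ∧
        t ≤ l.length / 2 * combineCost T d r n
  | [], acc, _, hacc =>
    ⟨acc, 0, hacc, fun p hp => ⟨p, by simpa using hp, subset_rfl⟩, by simp,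
      Eval.loop_stop (.fst _ _), by simp⟩
  | [x], acc, hl, hacc => by
    refine ⟨x :: acc, 0, ?_, ?_, by simp, ?_, by simp⟩
    · intro p hp
      rcases List.mem_cons.1 hp with rfl | hp
      · exact (hl p (by simp)).mono (by omega)
      · exact hacc p hp
    · intro p hp
      refine ⟨p, ?_, subset_rfl⟩
      simpa using hp
    · exact (Eval.loop_step (.fst _ _) (by simp)
        (.ifNil_true (.comp (.fst _ _) (.snd _ _)) (eval_moveStep _ _))
        (Eval.loop_stop (.fst _ _))).cast rfl
  | x :: y :: l, acc, hl, hacc => by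
    obtain ⟨N, t, hN, -, hev, ht⟩ := exists_combine hA hL0 hL hr hn (hl x (by simp))
      (hl y (by simp))
    obtain ⟨out, t', hout, hcov, hlen, hev', ht'⟩ := exists_eval_pairingLoop hA hL0 hL hr hn l
      ((x.1 ∪ y.1, N) :: acc) (fun p hp => hl p (by simp [hp])) (by
        intro p hp
        rcases List.mem_cons.1 hp with rfl | hp
        · exact hN
        · exact hacc p hp)
    refine ⟨out, t + t', hout, ?_, ?_, ?_, ?_⟩
    · obtain ⟨q, hq, hsub⟩ := hcov (x.1 ∪ y.1, N) (by simp)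
      intro p hp
      rcases hp with hp | hp
      · simp only [List.mem_cons] at hp
        rcases hp with rfl | rfl | hp
        · exact ⟨q, hq, Finset.subset_union_left.trans hsub⟩
        · exact ⟨q, hq, Finset.subset_union_right.trans hsub⟩
        · exact hcov p (Or.inl hp)
      · exact hcov p (Or.inr (by simp [hp]))
    · rw [hlen]
      simp only [List.length_cons]
      omega
    · exact (Eval.loop_step (.fst _ _) (by simp [encodeList])
        (.ifNil_false (.comp (.fst _ _) (.snd _ _)) (by simp)
          (eval_combineStep hev _ _)) hev').cast (by omega)
    · have h1 : (x :: y :: l).length / 2 = l.length / 2 + 1 := by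
        simp only [List.length_cons]; omega
      rw [h1, add_mul, one_mul, add_comm]
      exact Nat.add_le_add ht' ht

/-- The invariant uses `l.length - 1` because a leftover operator makes the length round up: `length
* 2 ^ e ≤ k` would not survive a pass, whereas `2 * (⌈s / 2⌉ - 1) ≤ s - 1`. -/
theorem exists_eval_tournament {A : Prog K} {T : ℕ → ℕ → ℕ} (hA : ComputesLCLM A 2 T)
    (hL0 : ∀ i, L i ≠ 0) (hL : ∀ i, BidegreeLE d r (L i)) (hr : 1 ≤ r) {e : ℕ}
    {l : List (Finset (Fin k) × K[X][X])} (hl0 : l ≠ [])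
    (hl : ∀ p ∈ l, IsPartialLCLM L d r (2 ^ e) p) (hcov : ∀ i, ∃ p ∈ l, i ∈ p.1)
    (hlen : (l.length - 1) * 2 ^ e ≤ k) :
    ∃ (M : K[X][X]) (t : ℕ), IsPartialLCLM L d r k (Finset.univ, M) ∧
      Eval (tournament A) (encodeList l) (.pair (encodeOp M) .nil) t ∧
      t ≤ ∑ j ∈ Finset.Ico e (Nat.log 2 k + 1), k / 2 ^ j * combineCost T d r (2 ^ j) := by
  induction hs : l.length using Nat.strong_induction_on generalizing l e with
  | _ s ih =>
  match l, hl0 with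
  | [p], _ =>
    have hp : p.1 = Finset.univ := Finset.eq_univ_of_forall (by simpa using hcov)
    have hpp := hl p (by simp)
    refine ⟨p.2, 0, ?_, Eval.loop_stop (.snd _ _), Nat.zero_le _⟩
    rw [← hp]
    exact ⟨hpp.1, hpp.2, card_finset_fin_le p.1, hpp.4⟩
  | x :: y :: l', _ =>
    set l := x :: y :: l' with hl'
    have hlen2 : 2 ≤ l.length := by simp [hl']
    obtain ⟨out, t, hout, hcov', hlen', hev, ht⟩ := exists_eval_pairingLoop hA hL0 hL hr
      (Nat.one_le_two_pow (n := e)) l [] hl (by simp)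
    simp only [List.length_nil, zero_add] at hlen'
    obtain ⟨M, t', hM, hev', ht'⟩ := ih out.length (by omega) (e := e + 1) (l := out)
      (by rintro rfl; simp at hlen'; omega)
      (by simpa only [pow_succ'] using hout)
      (fun i => by
        obtain ⟨p, hp, hip⟩ := hcov i
        obtain ⟨q, hq, hsub⟩ := hcov' p (Or.inl hp)
        exact ⟨q, hq, hsub hip⟩)
      (by
        refine le_trans ?_ hlen
        rw [pow_succ', ← mul_assoc]
        exact Nat.mul_le_mul_right _ (by omega)) rfl
    have hpass : Eval (pairingPass A) (encodeList l) (encodeList out) t :=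
      (Eval.comp (.comp (.pair (.id _) (.const _ _)) hev) (.snd _ _)).cast (by omega)
    -- With two operators left, `l.length - 1 ≥ 1`; so this level lies within the range of the sum.
    have hpow : 2 ^ e ≤ k := (Nat.le_mul_of_pos_left _ (by omega)).trans hlen
    have hlog : e < Nat.log 2 k + 1 :=
      Nat.lt_succ_of_le (Nat.le_log_of_pow_le (by norm_num) hpow)
    refine ⟨M, t + t', hM, (Eval.loop_step (.snd _ _) (by simp [Data.ofList]) hpass hev').cast
      (by omega), ?_⟩
    rw [Finset.sum_eq_sum_Ico_succ_bot hlog]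
    refine Nat.add_le_add (ht.trans (Nat.mul_le_mul_right _ ?_)) ht'
    rw [Nat.le_div_iff_mul_le (by positivity)]
    exact (Nat.mul_le_mul_right _ (by omega)).trans hlen

/-- A bound for the cost of computing the least common left multiple of `k` operators. -/
def manyCost (T : ℕ → ℕ → ℕ) (k d r : ℕ) : ℕ :=
  ∑ j ∈ Finset.Ico 0 (Nat.log 2 k + 1), k / 2 ^ j * combineCost T d r (2 ^ j) +
    combineCost T d r k

/-- Clamping at 1 covers `d = 0` and `r = 0`; the size bound needs `r ≥ 1`. -/
theorem computesLCLM_manyLCLM {A : Prog K} {T : ℕ → ℕ → ℕ} (hA : ComputesLCLM A 2 T) {k : ℕ}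
    (hk : 1 ≤ k) :
    ComputesLCLM (manyLCLM A) k fun d r => manyCost T k (max d 1) (max r 1) := by
  intro d r L hL0 hL
  dsimp only
  replace hL (i : Fin k) : BidegreeLE (max d 1) (max r 1) (L i) :=
    (hL i).mono (le_max_left _ _) (le_max_left _ _)
  have hr : 1 ≤ max r 1 := le_max_right _ _
  generalize max d 1 = d at hL ⊢
  generalize max r 1 = r at hL hr ⊢
  let l : List (Finset (Fin k) × K[X][X]) := List.ofFn fun i => ({i}, L i)
  have hlen : l.length = k := by simp [l]
  obtain ⟨M, t, hM, hev, ht⟩ := exists_eval_tournament hA hL0 hL hr (e := 0) (l := l)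
    (by rintro h; simp [h] at hlen; omega)
    (by
      intro p hp
      obtain ⟨i, rfl⟩ := (List.mem_ofFn' _ _).1 hp
      refine ⟨hL0 i, represents_singleton L i, by simp, (hL i).mono ?_ (by simp)⟩
      exact Nat.le_mul_of_pos_right _ (by positivity))
    (fun i => ⟨({i}, L i), (List.mem_ofFn' _ _).2 ⟨i, rfl⟩, by simp⟩)
    (by simp [hlen])
  -- For `k = 1` the tournament returns its input, perhaps not primitive. Combining `M` with itself
  -- once more gives a primitive operator with the same left multiples.
  obtain ⟨N, t', hN, hprim, hev', ht'⟩ := exists_combine hA hL0 hL hr hk hM hM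
  have hrep : Represents L Finset.univ N := by simpa using hN.represents
  refine ⟨N, t + t', hrep.isPrimitiveLCLM hprim, ?_, Nat.add_le_add ht ht'⟩
  have henc : encodeOps L = encodeList l := by
    simp [encodeOps, encodeList, l, List.map_ofFn, Function.comp_def]
  rw [henc]
  exact (Eval.comp (.comp hev (.pair (.fst _ _) (.pair (.fst _ _) (.const _ _)))) hev').cast
    (by omega)

end Programs

/-! ### Asymptotic estimate of the cost. -/

/-- The bound for `k` operators, in terms of the number of operators, the degree and the order. -/
def boundFn (α β : ℝ) (k d r : ℕ) : ℝ :=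
  (k : ℝ) ^ (α + 2 * β) * (r : ℝ) ^ (α + β) * (d : ℝ) ^ β

/-- Allows `log k` to be absorbed into the logarithm of the bound. -/
theorem natCast_le_boundFn {α β : ℝ} (hα : 2 ≤ α) (hβ : 1 ≤ β) {k d r : ℕ} (hk : 1 ≤ k) (hd : 1 ≤ d)
    (hr : 1 ≤ r) : (k : ℝ) ≤ boundFn α β k d r := by
  have hk' : (1 : ℝ) ≤ k := by exact_mod_cast hk
  have hd' : (1 : ℝ) ≤ d := by exact_mod_cast hd
  have hr' : (1 : ℝ) ≤ r := by exact_mod_cast hr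
  have h1 : (k : ℝ) ≤ (k : ℝ) ^ (α + 2 * β) := by
    simpa using Real.rpow_le_rpow_of_exponent_le hk' (show (1 : ℝ) ≤ α + 2 * β by linarith)
  have h2 : (1 : ℝ) ≤ (r : ℝ) ^ (α + β) := Real.one_le_rpow hr' (by linarith)
  have h3 : (1 : ℝ) ≤ (d : ℝ) ^ β := Real.one_le_rpow hd' (by linarith)
  calc (k : ℝ) = k * 1 * 1 := by ring
    _ ≤ _ := by unfold boundFn; gcongr

/-- The left side grows with `n` like `n ^ (α + 2β - 1)`, a nonnegative exponent, so `n = k` is the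
worst case. -/
theorem mul_rpow_le_boundFn {α β : ℝ} (hα : 2 ≤ α) (hβ : 1 ≤ β) {k d r n : ℕ} (hn : 1 ≤ n)
    (hnk : n ≤ k) :
    (k / n : ℝ) * (((n * r : ℕ) : ℝ) ^ α * ((4 * n ^ 2 * r * d : ℕ) : ℝ) ^ β) ≤
      4 ^ β * boundFn α β k d r := by
  have hn0 : (0 : ℝ) < n := by exact_mod_cast hn
  have hnk' : (n : ℝ) ≤ k := by exact_mod_cast hnk
  have hk0 : (0 : ℝ) < k := hn0.trans_le hnk'
  have hr0 : (0 : ℝ) ≤ r := by positivity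
  have hd0 : (0 : ℝ) ≤ d := by positivity
  have hsplit {x : ℝ} (hx : 0 < x) : x ^ (α + 2 * β) = x * x ^ (α + 2 * β - 1) := by
    rw [← Real.rpow_one_add' hx.le (by linarith)]; congr 1; ring
  have hprod : (((n * r : ℕ) : ℝ) ^ α * ((4 * n ^ 2 * r * d : ℕ) : ℝ) ^ β) =
      4 ^ β * boundFn α β n d r := by
    push_cast
    rw [Real.mul_rpow hn0.le hr0, Real.mul_rpow (by positivity) hd0,
      Real.mul_rpow (by positivity) hr0, Real.mul_rpow (by norm_num) (by positivity),
      ← Real.rpow_natCast (n : ℝ) 2, ← Real.rpow_mul hn0.le, boundFn, Real.rpow_add hn0,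
      Real.rpow_add_of_nonneg hr0 (by linarith) (by linarith)]
    push_cast
    ring
  rw [hprod, boundFn, boundFn, hsplit hn0, hsplit hk0]
  have hpow : (n : ℝ) ^ (α + 2 * β - 1) ≤ (k : ℝ) ^ (α + 2 * β - 1) :=
    Real.rpow_le_rpow hn0.le hnk' (by linarith)
  calc (k / n : ℝ) * (4 ^ β * (n * (n : ℝ) ^ (α + 2 * β - 1) * (r : ℝ) ^ (α + β) * (d : ℝ) ^ β))
      = 4 ^ β * (k * (n : ℝ) ^ (α + 2 * β - 1) * (r : ℝ) ^ (α + β) * (d : ℝ) ^ β) := by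
        field_simp
    _ ≤ _ := by gcongr

theorem one_le_log_three_add {x : ℝ} (hx : 0 ≤ x) : 1 ≤ Real.log (3 + x) := by
  rw [Real.le_log_iff_exp_le (by linarith)]
  have := Real.exp_one_lt_d9
  linarith

theorem natLog_add_one_le {k : ℕ} (hk : 1 ≤ k) {x : ℝ} (hkx : (k : ℝ) ≤ x) :
    ((Nat.log 2 k + 1 : ℕ) : ℝ) ≤ (1 / Real.log 2 + 1) * Real.log (3 + x) := by
  have hx : (0 : ℝ) ≤ x := le_trans (by positivity) hkx
  have h2 : 0 < Real.log 2 := Real.log_pos (by norm_num)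
  have h1 := one_le_log_three_add hx
  have h3 : (Nat.log 2 k : ℝ) * Real.log 2 ≤ Real.log (3 + x) := by
    rw [← Real.log_pow]
    refine Real.log_le_log (by positivity) ?_
    have : ((2 ^ Nat.log 2 k : ℕ) : ℝ) ≤ k := by
      exact_mod_cast Nat.pow_log_le_self 2 (by omega)
    push_cast at this
    linarith
  push_cast
  rw [add_mul, one_mul]
  refine add_le_add ?_ h1
  rw [div_mul_eq_mul_div, one_mul, le_div_iff₀ h2]
  exact h3

theorem isSoftO_manyCost {α β : ℝ} (hα : 2 ≤ α) (hβ : 1 ≤ β) {T : ℕ → ℕ → ℕ}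
    (hT : IsSoftO {n : ℕ × ℕ | 1 ≤ n.1 ∧ 1 ≤ n.2} (fun n => (T n.1 n.2 : ℝ))
      (fun n => (n.2 : ℝ) ^ α * (n.1 : ℝ) ^ β)) :
    IsSoftO {n : ℕ × ℕ × ℕ | 1 ≤ n.1 ∧ 1 ≤ n.2.1 ∧ 1 ≤ n.2.2}
      (fun n => (manyCost T n.1 n.2.1 n.2.2 : ℝ)) (fun n => boundFn α β n.1 n.2.1 n.2.2) := by
  obtain ⟨C, c, hC⟩ := hT
  -- The given constant might be negative.
  set C' : ℝ := max C 0 with hC'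
  have hC0 : 0 ≤ C' := le_max_right _ _
  set B : ℝ := β * Real.log 4 + 1 with hB
  have hlog4 : 0 ≤ Real.log 4 := Real.log_nonneg (by norm_num)
  have hB0 : 0 ≤ B := by positivity
  -- `1 / log 2 + 1` accounts for the levels, the last `1` for the final call; `B` compares `log (3
  -- + g)` with `log (3 + G)` when `g ≤ 4^β G`. The number of levels costs one more logarithm.
  refine ⟨(1 / Real.log 2 + 1 + 1) * (C' * 4 ^ β * B ^ c), c + 1, ?_⟩
  rintro ⟨k, d, r⟩ ⟨hk, hd, hr⟩
  dsimp only at hk hd hr ⊢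
  set G := boundFn α β k d r with hG
  have hkG : (k : ℝ) ≤ G := natCast_le_boundFn hα hβ hk hd hr
  have hk1 : (1 : ℝ) ≤ k := by exact_mod_cast hk
  have hG1 : 1 ≤ G := hk1.trans hkG
  have hl1 := one_le_log_three_add (zero_le_one.trans hG1)
  set ℓ := Real.log (3 + G) with hℓ
  set E := C' * 4 ^ β * B ^ c * G * ℓ ^ c with hE
  have hE0 : 0 ≤ E := by positivity
  have hcost {n : ℕ} (hn : 1 ≤ n) (hnk : n ≤ k) : (k / n : ℝ) * combineCost T d r n ≤ E := by
    have hn0 : (0 : ℝ) < n := by exact_mod_cast hn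
    have hnk' : (n : ℝ) ≤ k := by exact_mod_cast hnk
    have h1 := hC (4 * n ^ 2 * r * d, n * r)
      ⟨Nat.mul_pos (Nat.mul_pos (by positivity) hr) hd, Nat.mul_pos hn hr⟩
    have h2 := mul_rpow_le_boundFn (d := d) (r := r) hα hβ hn hnk
    dsimp only at h1
    set g : ℝ := ((n * r : ℕ) : ℝ) ^ α * ((4 * n ^ 2 * r * d : ℕ) : ℝ) ^ β with hg
    have hg0 : 0 ≤ g := by positivity
    have hkn : (1 : ℝ) ≤ k / n := (one_le_div hn0).2 hnk'
    have hgG : g ≤ 4 ^ β * G := (le_mul_of_one_le_left hg0 hkn).trans h2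
    have h4 : (1 : ℝ) ≤ 4 ^ β := Real.one_le_rpow (by norm_num) (by linarith)
    have hlog : Real.log (3 + g) ≤ B * ℓ := by
      calc Real.log (3 + g) ≤ Real.log (4 ^ β * (3 + G)) :=
            Real.log_le_log (by linarith) (by nlinarith)
        _ = β * Real.log 4 + ℓ := by
            rw [Real.log_mul (by positivity) (by positivity), Real.log_rpow (by norm_num)]
        _ ≤ β * Real.log 4 * ℓ + ℓ :=
            add_le_add (le_mul_of_one_le_right (by positivity) hl1) le_rfl
        _ = B * ℓ := by rw [hB]; ring
    have hlog0 : 0 ≤ Real.log (3 + g) := Real.log_nonneg (by linarith)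
    have hCC : C ≤ C' := le_max_left _ _
    calc (k / n : ℝ) * combineCost T d r n
        ≤ (k / n : ℝ) * (C * g * Real.log (3 + g) ^ c) := by
          refine mul_le_mul_of_nonneg_left ?_ (by positivity)
          exact h1
      _ ≤ (k / n : ℝ) * (C' * g * (B * ℓ) ^ c) := by gcongr
      _ = C' * ((k / n : ℝ) * g) * (B * ℓ) ^ c := by ring
      _ ≤ C' * (4 ^ β * G) * (B * ℓ) ^ c := by gcongr
      _ = E := by rw [hE, mul_pow]; ring
  have hsum : ((∑ j ∈ Finset.Ico 0 (Nat.log 2 k + 1),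
      k / 2 ^ j * combineCost T d r (2 ^ j) : ℕ) : ℝ) ≤ ((Nat.log 2 k + 1 : ℕ) : ℝ) * E := by
    rw [Nat.cast_sum]
    refine (Finset.sum_le_card_nsmul _ _ E fun j hj => ?_).trans (by simp)
    have hj' : 2 ^ j ≤ k := Nat.pow_le_of_le_log (by omega)
      (by have := (Finset.mem_Ico.1 hj).2; omega)
    refine le_trans ?_ (hcost (Nat.one_le_two_pow) hj')
    rw [Nat.cast_mul]
    gcongr
    exact Nat.cast_div_le
  have hlast : (combineCost T d r k : ℝ) ≤ E := by
    have := hcost hk le_rfl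
    rwa [div_self (by positivity), one_mul] at this
  have hnum := natLog_add_one_le hk hkG
  have h2 : 0 < Real.log 2 := Real.log_pos (by norm_num)
  calc (manyCost T k d r : ℝ) ≤ ((Nat.log 2 k + 1 : ℕ) : ℝ) * E + E := by
        rw [manyCost, Nat.cast_add]; exact add_le_add hsum hlast
    _ ≤ (1 / Real.log 2 + 1) * ℓ * E + ℓ * E := by
        gcongr
        exact le_mul_of_one_le_left hE0 hl1
    _ = _ := by rw [hE, pow_succ]; ring

end DiffOps
end

theorem theorem5 {K : Type*} [Field K] (α β : ℝ) (hα : 2 ≤ α) (hβ : 1 ≤ β)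
    (A : DiffOps.Prog K) (T : ℕ → ℕ → ℕ)
    (hA : DiffOps.ComputesLCLM A 2 T)
    (hT : DiffOps.IsSoftO {n : ℕ × ℕ | 1 ≤ n.1 ∧ 1 ≤ n.2}
      (fun n => (T n.1 n.2 : ℝ))
      (fun n => (n.2 : ℝ) ^ α * (n.1 : ℝ) ^ β)) :
    ∃ (B : DiffOps.Prog K) (T' : ℕ → ℕ → ℕ → ℕ),
      (∀ k : ℕ, 1 ≤ k → DiffOps.ComputesLCLM B k (T' k)) ∧
      DiffOps.IsSoftO {n : ℕ × ℕ × ℕ | 1 ≤ n.1 ∧ 1 ≤ n.2.1 ∧ 1 ≤ n.2.2}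
        (fun n => (T' n.1 n.2.1 n.2.2 : ℝ))
        (fun n => (n.1 : ℝ) ^ (α + 2 * β) * (n.2.2 : ℝ) ^ (α + β) * (n.2.1 : ℝ) ^ β) := by
  refine ⟨DiffOps.manyLCLM A, fun k d r => DiffOps.manyCost T k (max d 1) (max r 1),
    fun k hk => DiffOps.computesLCLM_manyLCLM hA hk, ?_⟩
  obtain ⟨C, c, hC⟩ := DiffOps.isSoftO_manyCost hα hβ hT
  refine ⟨C, c, fun n hn => ?_⟩
  dsimp only
  -- For parameters at least 1 the clamping has no effect.
  rw [max_eq_left hn.2.1, max_eq_left hn.2.2]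
  exact hC n hn
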